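/- Let $n\ge 1$ and let $F\subseteq E(K_{n,n})$ be a set of edges of the complete bipartite graph $K_{n,n}$. Let $\mathcal M(F)$ be the matching complex of $F$, that is, the abstract simplicial complex with vertex set $F$ whose faces are the sets of pairwise disjoint edges of $F$ (including the empty set). Then $$\eta_H(\mathcal M(F))\;\ge\;\frac{|F|}{n}-\frac n3-\frac12 .$$ Here, for a simplicial complex $\mathcal C$, $\eta_H(\mathcal C)$ denotes $2$ plus the largest integer $k$ such that the reduced simplicial homology group $\tilde H_j(\mathcal C;\mathbb Q)$ vanishes for every integer $j$ with $-1\le j\le k$, and $\eta_H(\mathcal C)=\infty$ if $\tilde H_j(\mathcal C;\mathbb Q)=0$ for all $j$. (For $k\le -2$ the condition is empty, so $\eta_H(\mathcal C)\ge 0$ always.) -/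

import Mathlib

open scoped ENNReal

noncomputable section

namespace PreAbstractSimplicialComplex

variable {V : Type*}

/-- The incidence sign of the vertex `v` in the simplex `s`, all simplices being oriented by one
fixed well-order of the vertex set: `(-1) ^ i`, where `i` is the number of vertices of `s` that
precede `v`. -/
def incidenceSign (s : Finset V) (v : V) : ℚ :=
  open Classical in (-1) ^ (s.filter fun u => WellOrderingRel u v).card

/-- The boundary of the oriented simplex `s`, that is, the sum of `± (s \ {v})` over the vertices
`v` of `s`. A single vertex has boundary `∅` (the augmentation), and `∅` has boundary `0`. -/
def simplexBoundary (s : Finset V) : Finset V →₀ ℚ :=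
  open Classical in ∑ v ∈ s, Finsupp.single (s.erase v) (incidenceSign s v)

variable (V) in
/-- The boundary map on rational chains. -/
def boundary : (Finset V →₀ ℚ) →ₗ[ℚ] (Finset V →₀ ℚ) :=
  Finsupp.linearCombination ℚ simplexBoundary

/-- The reduced simplicial `j`-chains of `K` with rational coefficients: the combinations of faces
with `j + 1` vertices. The empty face (which is not recorded in `K`) spans dimension `-1`. -/
def reducedChains (K : PreAbstractSimplicialComplex V) (j : ℤ) : Submodule ℚ (Finset V →₀ ℚ) :=
  Finsupp.supported ℚ ℚ {s | (s = ∅ ∨ s ∈ K.faces) ∧ (s.card : ℤ) = j + 1}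

/-- The reduced `j`-cycles. -/
def reducedCycles (K : PreAbstractSimplicialComplex V) (j : ℤ) : Submodule ℚ (Finset V →₀ ℚ) :=
  K.reducedChains j ⊓ LinearMap.ker (boundary V)

/-- The reduced `j`-boundaries. -/
def reducedBoundaries (K : PreAbstractSimplicialComplex V) (j : ℤ) :
    Submodule ℚ (Finset V →₀ ℚ) :=
  (K.reducedChains (j + 1)).map (boundary V)

theorem incidenceSign_cancel {s : Finset V} {u v : V} (hu : u ∈ s) (h : WellOrderingRel u v) :
    open Classical in
    incidenceSign s v * incidenceSign (s.erase v) u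
      = - (incidenceSign s u * incidenceSign (s.erase u) v) := by
  classical
  have hvu : ¬ WellOrderingRel v u := fun h' => asymm h h'
  have e1 : (s.erase v).filter (fun w => WellOrderingRel w u)
      = s.filter (fun w => WellOrderingRel w u) := by
    ext w
    simp only [Finset.mem_filter, Finset.mem_erase]
    constructor
    · rintro ⟨⟨-, a⟩, b⟩
      exact ⟨a, b⟩
    · rintro ⟨a, b⟩
      exact ⟨⟨fun e => hvu (e ▸ b), a⟩, b⟩
  have e2 : (s.erase u).filter (fun w => WellOrderingRel w v)
      = (s.filter (fun w => WellOrderingRel w v)).erase u := by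
    ext w
    simp only [Finset.mem_filter, Finset.mem_erase]
    tauto
  have e3 := Finset.card_erase_add_one
    (s := s.filter (fun w => WellOrderingRel w v)) (Finset.mem_filter.2 ⟨hu, h⟩)
  simp only [incidenceSign]
  have f1 : (open Classical in (s.erase v).filter (fun w => WellOrderingRel w u)).card
      = (s.filter (fun w => WellOrderingRel w u)).card := by rw [← e1]
  have f2 : (s.filter (fun w => WellOrderingRel w v)).card
      = ((s.erase u).filter (fun w => WellOrderingRel w v)).card + 1 := by
    rw [e2, e3]
  rw [f1, f2, pow_succ]
  ring

theorem boundary_simplexBoundary (s : Finset V) : boundary V (simplexBoundary s) = 0 := by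
  classical
  have h1 : boundary V (simplexBoundary s)
      = ∑ v ∈ s, ∑ u ∈ s.erase v, Finsupp.single ((s.erase v).erase u)
          (incidenceSign s v * incidenceSign (s.erase v) u) := by
    simp only [simplexBoundary, map_sum, boundary, Finsupp.linearCombination_single,
      Finset.smul_sum, Finsupp.smul_single, smul_eq_mul]
  rw [h1, Finset.sum_sigma']
  refine Finset.sum_involution (fun p _ => ⟨p.2, p.1⟩) ?_ ?_ ?_ ?_
  · rintro ⟨v, u⟩ hp
    simp only [Finset.mem_sigma, Finset.mem_erase] at hp
    obtain ⟨hv, huv, hu⟩ := hp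
    simp only
    rw [Finset.erase_right_comm, ← Finsupp.single_add]
    have : incidenceSign s v * incidenceSign (s.erase v) u
        + incidenceSign s u * incidenceSign (s.erase u) v = 0 := by
      rcases trichotomous_of WellOrderingRel u v with h | h | h
      · have := incidenceSign_cancel hu h
        linarith
      · exact absurd h huv
      · have := incidenceSign_cancel hv h
        linarith
    rw [this, Finsupp.single_zero]
  · rintro ⟨v, u⟩ hp _ he
    simp only [Finset.mem_sigma, Finset.mem_erase] at hp
    simp only [Sigma.mk.injEq] at he
    exact hp.2.1 he.1
  · rintro ⟨v, u⟩ hp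
    simp only [Finset.mem_sigma, Finset.mem_erase] at hp ⊢
    exact ⟨hp.2.2, fun e => hp.2.1 e.symm, hp.1⟩
  · rintro ⟨v, u⟩ _
    rfl

theorem boundary_boundary (c : Finset V →₀ ℚ) : boundary V (boundary V c) = 0 := by
  have h : (boundary V).comp (boundary V) = 0 := by
    refine Finsupp.lhom_ext fun s a => ?_
    simp only [LinearMap.comp_apply, LinearMap.zero_apply]
    have : boundary V (Finsupp.single s a) = a • simplexBoundary s := by
      simp [boundary]
    rw [this, map_smul, boundary_simplexBoundary, smul_zero]
  exact LinearMap.congr_fun h c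

theorem boundary_mem_reducedChains (K : PreAbstractSimplicialComplex V) {j : ℤ}
    {c : Finset V →₀ ℚ} (hc : c ∈ K.reducedChains (j + 1)) :
    boundary V c ∈ K.reducedChains j := by
  classical
  rw [boundary, Finsupp.linearCombination_apply, Finsupp.sum]
  refine Submodule.sum_mem _ fun s hs => Submodule.smul_mem _ _ ?_
  obtain ⟨hK, hcard⟩ := (Finsupp.mem_supported ℚ c).1 hc hs
  refine Submodule.sum_mem _ fun v hv => Finsupp.single_mem_supported ℚ _ ?_
  have h1 := Finset.card_erase_add_one hv
  refine ⟨?_, ?_⟩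
  · rcases Finset.eq_empty_or_nonempty (s.erase v) with h | h
    · left
      convert h
    · right
      rcases hK with rfl | hK
      · simp at hv
      · convert (K.isRelLowerSet_faces hK).2 (Finset.erase_subset v s) h
  · have : ((s.erase v).card : ℤ) = j + 1 := by omega
    convert this

/-- Every boundary is a cycle. -/
theorem reducedBoundaries_le_reducedCycles (K : PreAbstractSimplicialComplex V) (j : ℤ) :
    K.reducedBoundaries j ≤ K.reducedCycles j := by
  rintro _ ⟨c, hc, rfl⟩
  exact ⟨K.boundary_mem_reducedChains hc, boundary_boundary c⟩

/-- The `j`-th reduced simplicial homology group of `K` with rational coefficients: reduced cycles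
modulo reduced boundaries. -/
abbrev ReducedHomology (K : PreAbstractSimplicialComplex V) (j : ℤ) : Type _ :=
  K.reducedCycles j ⧸ (K.reducedBoundaries j).submoduleOf (K.reducedCycles j)

/-- `K` is homologically `k`-connected: its rational reduced homology vanishes in all dimensions
`-1 ≤ j ≤ k`. -/
def IsHomologicallyConnected (K : PreAbstractSimplicialComplex V) (k : ℤ) : Prop :=
  ∀ j : ℤ, -1 ≤ j → j ≤ k → Subsingleton (K.ReducedHomology j)

/-- The homological connectivity `η_H`: the largest `k` for which `K` is homologically
`k`-connected, plus `2`, and `⊤` if there is no largest such `k`. Since every `K` is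
`(-2)`-connected, only the values `k = m - 2` with `m` a natural number matter. -/
def etaH (K : PreAbstractSimplicialComplex V) : ℕ∞ :=
  ⨆ (m : ℕ) (_ : K.IsHomologicallyConnected ((m : ℤ) - 2)), (m : ℕ∞)

end PreAbstractSimplicialComplex

/-- A matching: a set of edges no two of which share an endpoint. -/
def IsEdgeMatching {V : Type*} (s : Finset (Sym2 V)) : Prop :=
  ∀ e ∈ s, ∀ f ∈ s, e ≠ f → ∀ v : V, v ∈ e → v ∉ f

/-- The matching complex `M(F)` of an edge set `F`: its vertices are the edges in `F`, and its
(nonempty) faces are the (nonempty) matchings contained in `F`. -/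
def matchingComplex {V : Type*} (F : Set (Sym2 V)) : PreAbstractSimplicialComplex (Sym2 V) where
  faces := {s | s.Nonempty ∧ (s : Set (Sym2 V)) ⊆ F ∧ IsEdgeMatching s}
  isRelLowerSet_faces := fun {_} hs =>
    ⟨hs.1, fun _ hts ht => ⟨ht, fun _ hx => hs.2.1 (hts hx),
      fun e he f hf => hs.2.2 e (hts he) f (hts hf)⟩⟩

end

/-!
The proof is Hodge theory on the rational chains with a one-line lower bound for the Laplacian.
Over `ℚ` the standard dot product on chains is positive definite, so every `j`-cycle is the sum of a
boundary and of a cycle `z` orthogonal to all boundaries, and it suffices to show that such a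
harmonic `z` vanishes (`subsingleton_reducedHomology_of_harmonic`).

Let `d = j + 1` be the number of edges of the matchings on which `z` lives. For a matching `r` with
`d - 1` edges put `w r u = ± z (r ∪ {u})`, so that `∑ u, w r u = 0` expresses that the boundary of
`z` has no `r`-coefficient. Two edges of a bipartite graph are disjoint, or share their left
endpoint, or share their right endpoint, and only equal edges share both. Expanding
`(∑ u, w r u) ^ 2`, the pairs with a common left endpoint contribute a sum of squares, as do those
with a common right endpoint; what is left says that the sum of `w r u * w r v` over disjoint pairs
is at most `∑ u, w r u ^ 2` (`sum_compatible_mul_le`). Summing over `r`, the right-hand side becomes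
`d * ∑ s, z s ^ 2`. Orthogonality of `z` to the boundary of each matching `t` with `d + 1` edges,
squared and summed over `t`, identifies the left-hand side with `∑ s, ext s * z s ^ 2`, where
`ext s` is the number of edges of `F` disjoint from `s`, because the incidence signs satisfy
`incidenceSign_cancel`. So `z = 0` as soon as `ext s > d` for all matchings `s` with `d` edges
(`eq_zero_of_harmonic`).

In `K_{n,n}` exactly `n ^ 2 - (n - d) ^ 2` edges meet a matching with `d` edges, hence
`ext s ≥ |F| - n ^ 2 + (n - d) ^ 2`, and this exceeds `d` whenever `d < |F| / n - n / 3 - 1 / 2`.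
-/

namespace PreAbstractSimplicialComplex

variable {V : Type*}

/-! ### Harmonic chains -/

theorem boundary_single_one (t : Finset V) :
    boundary V (Finsupp.single t 1) = simplexBoundary t := by
  simp [boundary]

/-- The standard dot product on the rational chains over a finite vertex set. -/
noncomputable def chainDot (V : Type*) [Fintype V] : LinearMap.BilinForm ℚ (Finset V →₀ ℚ) :=
  LinearMap.mk₂ ℚ (fun x y => ∑ s, x s * y s)
    (fun x y z => by simp [add_mul, Finset.sum_add_distrib])
    (fun c x y => by simp [Finset.mul_sum, mul_assoc])
    (fun x y z => by simp [mul_add, Finset.sum_add_distrib])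
    (fun c x y => by simp [Finset.mul_sum, mul_left_comm])

theorem chainDot_apply [Fintype V] (x y : Finset V →₀ ℚ) :
    chainDot V x y = ∑ s, x s * y s := rfl

open Classical in
theorem chainDot_simplexBoundary [Fintype V] (t : Finset V) (z : Finset V →₀ ℚ) :
    chainDot V (simplexBoundary t) z = ∑ v ∈ t, incidenceSign t v * z (t.erase v) := by
  rw [simplexBoundary, map_sum, LinearMap.sum_apply]
  refine Finset.sum_congr rfl fun v _ => ?_
  simp [chainDot_apply, Finsupp.single_apply]

open Classical in
/-- Homology vanishes if every harmonic chain, that is, every cycle orthogonal to the boundaries of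
all simplices of one dimension more, is zero. -/
theorem subsingleton_reducedHomology_of_harmonic [Fintype V]
    (K : PreAbstractSimplicialComplex V) (j : ℤ)
    (h : ∀ z ∈ K.reducedCycles j,
      (∀ t : Finset V, (t = ∅ ∨ t ∈ K.faces) → (t.card : ℤ) = j + 1 + 1 →
        ∑ v ∈ t, incidenceSign t v * z (t.erase v) = 0) → z = 0) :
    Subsingleton (K.ReducedHomology j) := by
  rw [Submodule.Quotient.subsingleton_iff, Submodule.submoduleOf_eq_top]
  intro c hc
  have hrefl : (chainDot V).IsRefl := fun x y hxy => by
    simpa [chainDot_apply, mul_comm] using hxy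
  have hdisj : Disjoint (K.reducedBoundaries j)
      ((chainDot V).orthogonal (K.reducedBoundaries j)) := by
    rw [Submodule.disjoint_def]
    intro x hx hx'
    have h0 : chainDot V x x = 0 := hx' x hx
    rw [chainDot_apply, Finset.sum_eq_zero_iff_of_nonneg fun s _ => mul_self_nonneg _] at h0
    ext s
    simpa using h0 s (Finset.mem_univ s)
  have hcompl :=
    (LinearMap.BilinForm.isCompl_orthogonal_iff_disjoint hrefl).2 hdisj
  obtain ⟨b, z, hb, hz, rfl⟩ := Submodule.codisjoint_iff_exists_add_eq.1 hcompl.codisjoint c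
  have hz0 : z = 0 := by
    refine h z ?_ fun t ht hcard => ?_
    · have := Submodule.sub_mem _ hc (K.reducedBoundaries_le_reducedCycles j hb)
      simpa using this
    · rw [← chainDot_simplexBoundary]
      refine hz _ ⟨Finsupp.single t 1, ?_, boundary_single_one t⟩
      exact Finsupp.single_mem_supported ℚ _ ⟨ht, hcard⟩
  simpa [hz0] using hb

/-! ### Summation over flags of simplices -/

open Classical in
theorem sum_sum_mem_eq_sum_sum_insert [Fintype V] {M : Type*} [AddCommMonoid M]
    (f : Finset V → V → M) :
    ∑ s : Finset V, ∑ v ∈ s, f s v = ∑ r : Finset V, ∑ v ∈ rᶜ, f (insert v r) v := by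
  rw [Finset.sum_sigma', Finset.sum_sigma']
  refine Finset.sum_bij' (fun p _ => ⟨p.1.erase p.2, p.2⟩) (fun p _ => ⟨insert p.2 p.1, p.2⟩)
    ?_ ?_ ?_ ?_ ?_ <;> rintro ⟨s, v⟩ hp <;>
    simp only [Finset.mem_sigma, Finset.mem_univ, true_and, Finset.mem_compl] at hp <;>
    simp [hp, Finset.insert_erase]

open Classical in
theorem sum_sum_sum_mem_eq_sum_sum_sum_insert [Fintype V] {M : Type*} [AddCommMonoid M]
    (f : Finset V → V → V → M) :
    ∑ t : Finset V, ∑ u ∈ t, ∑ v ∈ t.erase u, f t u v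
      = ∑ r : Finset V, ∑ v ∈ rᶜ, ∑ u ∈ (insert v r)ᶜ, f (insert u (insert v r)) u v := by
  rw [sum_sum_mem_eq_sum_sum_insert fun t u => ∑ v ∈ t.erase u, f t u v,
    ← sum_sum_mem_eq_sum_sum_insert fun s v => ∑ u ∈ sᶜ, f (insert u s) u v]
  refine Finset.sum_congr rfl fun s _ => ?_
  rw [Finset.sum_comm]
  refine Finset.sum_congr rfl fun u hu => ?_
  rw [Finset.erase_insert (Finset.mem_compl.1 hu)]

open Classical in
theorem boundary_apply [Fintype V] (z : Finset V →₀ ℚ) (r : Finset V) :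
    boundary V z r = ∑ v ∈ rᶜ, incidenceSign (insert v r) v * z (insert v r) := by
  have h1 : boundary V z r
      = ∑ s : Finset V, ∑ v ∈ s, if s.erase v = r then incidenceSign s v * z s else 0 := by
    rw [boundary, Finsupp.linearCombination_apply, Finsupp.sum_fintype _ _ (by simp),
      Finsupp.finsetSum_apply]
    refine Finset.sum_congr rfl fun s _ => ?_
    rw [Finsupp.smul_apply, simplexBoundary, Finsupp.finsetSum_apply, Finset.smul_sum]
    refine Finset.sum_congr rfl fun v _ => ?_
    rw [Finsupp.single_apply]
    split_ifs <;> simp [mul_comm]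
  rw [h1, sum_sum_mem_eq_sum_sum_insert
    fun s v => if s.erase v = r then incidenceSign s v * z s else 0,
    Finset.sum_eq_single r]
  · refine Finset.sum_congr rfl fun v hv => ?_
    rw [Finset.erase_insert (Finset.mem_compl.1 hv), if_pos rfl]
  · intro q _ hq
    refine Finset.sum_eq_zero fun v hv => ?_
    rw [Finset.erase_insert (Finset.mem_compl.1 hv), if_neg hq]
  · simp

theorem incidenceSign_mul_self (s : Finset V) (v : V) :
    incidenceSign s v * incidenceSign s v = 1 := by
  rw [incidenceSign, ← mul_pow]
  simp

open Classical in
/-- The two ways of completing `r` to `r ∪ {u, v}` carry opposite products of incidence signs. -/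
theorem incidenceSign_insert_mul {r : Finset V} {u v : V} (hu : u ∉ r) (hv : v ∉ r)
    (huv : u ≠ v) :
    incidenceSign (insert u (insert v r)) u * incidenceSign (insert u (insert v r)) v
      = -(incidenceSign (insert u r) u * incidenceSign (insert v r) v) := by
  set t := insert u (insert v r) with ht
  have e1 : t.erase u = insert v r := Finset.erase_insert (by simp [huv, hu])
  have e2 : t.erase v = insert u r := by
    rw [ht, Finset.insert_comm]
    exact Finset.erase_insert (by simp [huv.symm, hv])
  have hc : incidenceSign t v * incidenceSign (insert u r) u
      = -(incidenceSign t u * incidenceSign (insert v r) v) := by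
    rcases trichotomous_of WellOrderingRel u v with h | h | h
    · have := incidenceSign_cancel (s := t) (by simp [ht]) h
      rwa [e1, e2] at this
    · exact absurd h huv
    · have := incidenceSign_cancel (s := t) (by simp [ht]) h
      rw [e1, e2] at this
      linarith
  -- All signs square to `1`, so `hc` may be multiplied by two of them.
  have h1 := incidenceSign_mul_self (insert u r) u
  have h2 := incidenceSign_mul_self t u
  linear_combination (incidenceSign t u * incidenceSign (insert u r) u) * hc
    - incidenceSign t u * incidenceSign t v * h1
    - incidenceSign (insert u r) u * incidenceSign (insert v r) v * h2

/-! ### The spectral estimate for matchings in bipartite graphs -/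

open Classical in
theorem sum_sum_ite_eq_nonneg [Fintype V] {α : Type*} (l : V → α) (w : V → ℚ) :
    0 ≤ ∑ u, ∑ v, if l u = l v then w u * w v else 0 := by
  have h : ∑ u, ∑ v, (if l u = l v then w u * w v else 0)
      = ∑ i ∈ Finset.univ.image l, (∑ u, if l u = i then w u else 0) ^ 2 := by
    simp_rw [sq, Finset.sum_mul_sum]
    rw [Finset.sum_comm]
    simp_rw [Finset.sum_comm (s := Finset.univ.image l)]
    rw [Finset.sum_comm]
    refine Finset.sum_congr rfl fun u _ => Finset.sum_congr rfl fun v _ => ?_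
    rw [Finset.sum_eq_single_of_mem (l u) (Finset.mem_image_of_mem l (Finset.mem_univ u))
      fun i _ hi => by simp [hi.symm]]
    by_cases e : l u = l v <;> simp [e, eq_comm]
  rw [h]
  exact Finset.sum_nonneg fun i _ => sq_nonneg _

open Classical in
/-- If edges are determined by their endpoints `l` and `ρ`, then for edge weights of total `0` the
sum of the products over disjoint pairs is at most the sum of the squares. -/
theorem sum_compatible_mul_le [Fintype V] {α β : Type*} (l : V → α) (ρ : V → β) (w : V → ℚ)
    (hinj : ∀ u v, w u ≠ 0 → w v ≠ 0 → l u = l v → ρ u = ρ v → u = v) (hw : ∑ u, w u = 0) :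
    ∑ u, ∑ v, (if l u ≠ l v ∧ ρ u ≠ ρ v then w u * w v else 0) ≤ ∑ u, w u ^ 2 := by
  have h0 : ∑ u, ∑ v, w u * w v = 0 := by
    rw [← Finset.sum_mul_sum, hw, zero_mul]
  have hdiag : ∑ u, w u ^ 2 = ∑ u, ∑ v, if u = v then w u * w v else 0 := by
    simp [sq]
  have hsplit : ∑ u, ∑ v, (if l u ≠ l v ∧ ρ u ≠ ρ v then w u * w v else 0)
      + ∑ u, ∑ v, (if l u = l v then w u * w v else 0)
      + ∑ u, ∑ v, (if ρ u = ρ v then w u * w v else 0)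
      = ∑ u, ∑ v, w u * w v + ∑ u, ∑ v, if u = v then w u * w v else 0 := by
    simp only [← Finset.sum_add_distrib]
    refine Finset.sum_congr rfl fun u _ => Finset.sum_congr rfl fun v _ => ?_
    by_cases hu : w u = 0
    · simp [hu]
    by_cases hv : w v = 0
    · simp [hv]
    have := hinj u v hu hv
    by_cases e : u = v
    · subst e
      simp
    · by_cases e1 : l u = l v <;> by_cases e2 : ρ u = ρ v <;> simp_all
  have h1 := sum_sum_ite_eq_nonneg l w
  have h2 := sum_sum_ite_eq_nonneg ρ w
  linarith

/-- The sets `s ⊆ F` on which both endpoint maps `l` and `ρ` are injective: the matchings in `F`,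
the empty one included, when `F` is a set of edges with endpoints `l e` and `ρ e`. -/
def IsRookPlacement {α β : Type*} (F : Finset V) (l : V → α) (ρ : V → β) (s : Finset V) : Prop :=
  s ⊆ F ∧ ∀ e ∈ s, ∀ f ∈ s, e ≠ f → l e ≠ l f ∧ ρ e ≠ ρ f

open Classical in
theorem IsRookPlacement.insert_insert {α β : Type*} {F : Finset V} {l : V → α} {ρ : V → β}
    {r : Finset V} {u v : V} (hu : IsRookPlacement F l ρ (insert u r))
    (hv : IsRookPlacement F l ρ (insert v r)) (huv : l u ≠ l v ∧ ρ u ≠ ρ v) :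
    IsRookPlacement F l ρ (insert u (insert v r)) := by
  refine ⟨Finset.insert_subset (hu.1 (Finset.mem_insert_self u r)) hv.1, ?_⟩
  intro e he f hf hef
  have hu' := hu.2 e
  have hv' := hv.2 e
  simp only [Finset.mem_insert] at he hf hu' hv'
  rcases he with rfl | rfl | he <;> rcases hf with rfl | rfl | hf
  · exact absurd rfl hef
  · exact huv
  · exact hu' (Or.inl rfl) f (Or.inr hf) hef
  · exact ⟨huv.1.symm, huv.2.symm⟩
  · exact absurd rfl hef
  · exact hv' (Or.inl rfl) f (Or.inr hf) hef
  · exact hu' (Or.inr he) _ (Or.inl rfl) hef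
  · exact hv' (Or.inr he) _ (Or.inl rfl) hef
  · exact hv' (Or.inr he) f (Or.inr hf) hef

open Classical in
/-- A harmonic chain on the matchings with `d` edges is zero if each of these matchings can be
extended by more than `d` edges. -/
theorem eq_zero_of_harmonic [Fintype V] {α β : Type*} {F : Finset V} {l : V → α} {ρ : V → β}
    (hinj : ∀ u ∈ F, ∀ v ∈ F, l u = l v → ρ u = ρ v → u = v) {d : ℕ} {z : Finset V →₀ ℚ}
    (hz : ∀ s, z s ≠ 0 → IsRookPlacement F l ρ s ∧ s.card = d)
    (hext : ∀ s, IsRookPlacement F l ρ s → s.card = d →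
      d < (sᶜ.filter fun e => IsRookPlacement F l ρ (insert e s)).card)
    (hcycle : ∀ r, ∑ v ∈ rᶜ, incidenceSign (insert v r) v * z (insert v r) = 0)
    (hcocycle : ∀ t, IsRookPlacement F l ρ t → t.card = d + 1 →
      ∑ v ∈ t, incidenceSign t v * z (t.erase v) = 0) :
    z = 0 := by
  set P := IsRookPlacement F l ρ with hP
  set w : Finset V → V → ℚ := fun r u =>
    if u ∈ r then 0 else incidenceSign (insert u r) u * z (insert u r) with hw
  set g : Finset V → V → ℚ := fun t v => incidenceSign t v * z (t.erase v) with hg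
  have hw_sum : ∀ r (f : V → ℚ → ℚ), (∀ u, f u 0 = 0) →
      ∑ u, f u (w r u)
        = ∑ u ∈ rᶜ, f u (incidenceSign (insert u r) u * z (insert u r)) := by
    intro r f hf
    rw [← Finset.sum_subset (Finset.subset_univ rᶜ)]
    · refine Finset.sum_congr rfl fun u hu => ?_
      simp [hw, Finset.mem_compl.1 hu]
    · intro u _ hu
      have : u ∈ r := by simpa using hu
      simp [hw, this, hf]
  have hwP : ∀ r u, w r u ≠ 0 → P (insert u r) := by
    intro r u h
    refine (hz _ fun h0 => h ?_).1
    simp [hw, h0]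
  -- The sum of the squares over all codimension-one pairs counts each matching `d` times.
  have hsq : ∑ r, ∑ u, w r u ^ 2 = ∑ s, (d : ℚ) * z s ^ 2 := by
    have h1 : ∀ r, ∑ u, w r u ^ 2 = ∑ u ∈ rᶜ, z (insert u r) ^ 2 := by
      intro r
      rw [hw_sum r (fun _ x => x ^ 2) (by simp)]
      refine Finset.sum_congr rfl fun u _ => ?_
      rw [mul_pow, sq (incidenceSign _ _), incidenceSign_mul_self, one_mul]
    simp_rw [h1]
    rw [← sum_sum_mem_eq_sum_sum_insert fun s _ => z s ^ 2]
    refine Finset.sum_congr rfl fun s _ => ?_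
    by_cases h : z s = 0
    · simp [h]
    · simp [(hz s h).2]
  have hle : ∑ r, ∑ v, ∑ u, (if l v ≠ l u ∧ ρ v ≠ ρ u then w r v * w r u else 0)
      ≤ ∑ s, (d : ℚ) * z s ^ 2 := by
    rw [← hsq]
    refine Finset.sum_le_sum fun r _ => sum_compatible_mul_le l ρ (w r) ?_ ?_
    · intro u v hu hv
      exact hinj u ((hwP r u hu).1 (Finset.mem_insert_self u r))
        v ((hwP r v hv).1 (Finset.mem_insert_self v r))
    · rw [hw_sum r (fun _ x => x) (by simp)]
      exact hcycle r
  have hgg : ∀ t, P t → (∑ u ∈ t, g t u ^ 2)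
      + ∑ u ∈ t, ∑ v ∈ t.erase u, g t u * g t v = 0 := by
    intro t ht
    have h0 : ∑ v ∈ t, g t v = 0 := by
      by_cases hc : t.card = d + 1
      · exact hcocycle t ht hc
      · refine Finset.sum_eq_zero fun v hv => ?_
        have : z (t.erase v) = 0 := by
          by_contra h
          have h1 := (hz _ h).2
          have h2 := Finset.card_erase_add_one hv
          omega
        simp [hg, this]
    rw [← Finset.sum_add_distrib]
    refine Finset.sum_eq_zero fun u hu => ?_
    rw [sq, ← Finset.mul_sum, ← mul_add, Finset.add_sum_erase _ _ hu, h0, mul_zero]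
  have hdiag : ∑ t, (if P t then ∑ u ∈ t, g t u ^ 2 else 0)
      = ∑ s, ((sᶜ.filter fun e => P (insert e s)).card : ℚ) * z s ^ 2 := by
    have h1 : ∀ t, (if P t then ∑ u ∈ t, g t u ^ 2 else 0)
        = ∑ u ∈ t, if P t then z (t.erase u) ^ 2 else 0 := by
      intro t
      split_ifs
      · refine Finset.sum_congr rfl fun u _ => ?_
        rw [hg, mul_pow, sq (incidenceSign _ _), incidenceSign_mul_self, one_mul]
      · simp
    simp_rw [h1]
    rw [sum_sum_mem_eq_sum_sum_insert fun t u => if P t then z (t.erase u) ^ 2 else 0]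
    refine Finset.sum_congr rfl fun s _ => ?_
    rw [← nsmul_eq_mul, ← Finset.sum_const, Finset.sum_filter]
    refine Finset.sum_congr rfl fun u hu => ?_
    rw [Finset.erase_insert (Finset.mem_compl.1 hu)]
  have hoff : ∑ t, (if P t then ∑ u ∈ t, ∑ v ∈ t.erase u, g t u * g t v else 0)
      = -∑ r, ∑ v, ∑ u, (if l v ≠ l u ∧ ρ v ≠ ρ u then w r v * w r u else 0) := by
    have h1 : ∀ t, (if P t then ∑ u ∈ t, ∑ v ∈ t.erase u, g t u * g t v else 0)
        = ∑ u ∈ t, ∑ v ∈ t.erase u, if P t then g t u * g t v else 0 := by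
      intro t
      split_ifs <;> simp
    simp_rw [h1]
    rw [sum_sum_sum_mem_eq_sum_sum_sum_insert fun t u v => if P t then g t u * g t v else 0,
      ← Finset.sum_neg_distrib]
    refine Finset.sum_congr rfl fun r _ => ?_
    rw [← Finset.sum_neg_distrib]
    refine Finset.sum_subset_zero_on_sdiff (Finset.subset_univ _) ?_ fun v hv => ?_
    · intro v hv
      have : v ∈ r := by simpa using hv
      simp [hw, this]
    rw [← Finset.sum_neg_distrib]
    refine Finset.sum_subset_zero_on_sdiff (Finset.subset_univ _) ?_ fun u hu => ?_
    · intro u hu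
      have : u = v ∨ u ∈ r := by
        rwa [Finset.mem_sdiff, Finset.mem_compl, not_not, Finset.mem_insert,
          and_iff_right (Finset.mem_univ u)] at hu
      rcases this with rfl | h
      · simp
      · simp [hw, h]
    have hv' : v ∉ r := Finset.mem_compl.1 hv
    obtain ⟨huv, hu'⟩ : u ≠ v ∧ u ∉ r := by
      rwa [Finset.mem_compl, Finset.mem_insert, not_or] at hu
    have e1 : (insert u (insert v r)).erase u = insert v r :=
      Finset.erase_insert (by simp [huv, hu'])
    have e2 : (insert u (insert v r)).erase v = insert u r := by
      rw [Finset.insert_comm]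
      exact Finset.erase_insert (by simp [huv.symm, hv'])
    by_cases ht : P (insert u (insert v r))
    · have hc := ht.2 v (by simp) u (by simp) huv.symm
      rw [if_pos ht, if_pos hc]
      simp only [hg, hw, e1, e2, if_neg hv', if_neg hu']
      linear_combination z (insert v r) * z (insert u r) * incidenceSign_insert_mul hu' hv' huv
    · rw [if_neg ht]
      split_ifs with hc
      · by_cases h1 : w r v = 0
        · simp [h1]
        by_cases h2 : w r u = 0
        · simp [h2]
        exact absurd ((hwP r u h2).insert_insert (hwP r v h1) ⟨hc.1.symm, hc.2.symm⟩) ht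
      · simp
  have htotal : ∑ s, ((sᶜ.filter fun e => P (insert e s)).card : ℚ) * z s ^ 2
      ≤ ∑ s, (d : ℚ) * z s ^ 2 := by
    have h0 : ∑ t, (if P t then ∑ u ∈ t, g t u ^ 2 else 0)
        + ∑ t, (if P t then ∑ u ∈ t, ∑ v ∈ t.erase u, g t u * g t v else 0) = 0 := by
      rw [← Finset.sum_add_distrib]
      refine Finset.sum_eq_zero fun t _ => ?_
      split_ifs with ht
      · exact hgg t ht
      · simp
    rw [hdiag, hoff] at h0
    linarith
  ext s
  by_contra h
  refine absurd htotal (not_le.2 (Finset.sum_lt_sum (fun q _ => ?_) ⟨s, Finset.mem_univ s, ?_⟩))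
  · by_cases hq : z q = 0
    · simp [hq]
    · refine mul_le_mul_of_nonneg_right ?_ (sq_nonneg _)
      exact_mod_cast (hext q (hz q hq).1 (hz q hq).2).le
  · have hs : z s ≠ 0 := by simpa using h
    refine mul_lt_mul_of_pos_right ?_ (by positivity)
    exact_mod_cast hext s (hz s hs).1 (hz s hs).2

/-! ### Counting extensions of a matching -/

open Classical in
/-- Edges of `F` that extend the matching `s` are obtained by discarding the at most
`n ^ 2 - (n - d) ^ 2` edges that meet `s`. -/
theorem card_le_card_extensions_add {n d : ℕ} [Fintype V] {F : Finset V} {l ρ : V → Fin n}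
    (hinj : ∀ u ∈ F, ∀ v ∈ F, l u = l v → ρ u = ρ v → u = v) {s : Finset V}
    (hs : IsRookPlacement F l ρ s) (hd : s.card = d) :
    d ≤ n ∧ F.card + (n - d) ^ 2
      ≤ (sᶜ.filter fun e => IsRookPlacement F l ρ (insert e s)).card + n ^ 2 := by
  set A := s.image l with hA
  set B := s.image ρ with hB
  have hAc : A.card = d := by
    rw [hA, Finset.card_image_of_injOn, hd]
    intro e he f hf h
    by_contra hne
    exact (hs.2 e he f hf hne).1 h
  have hBc : B.card = d := by
    rw [hB, Finset.card_image_of_injOn, hd]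
    intro e he f hf h
    by_contra hne
    exact (hs.2 e he f hf hne).2 h
  have hdn : d ≤ n := by
    simpa [hAc] using Finset.card_le_univ A
  refine ⟨hdn, ?_⟩
  have hsplit := Finset.card_filter_add_card_filter_not (s := F) (fun e => l e ∉ A ∧ ρ e ∉ B)
  have hfree : (F.filter fun e => l e ∉ A ∧ ρ e ∉ B).card
      ≤ (sᶜ.filter fun e => IsRookPlacement F l ρ (insert e s)).card := by
    refine Finset.card_le_card fun e he => ?_
    simp only [Finset.mem_filter, hA, hB, Finset.mem_image, not_exists, not_and] at he
    obtain ⟨heF, h1, h2⟩ := he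
    simp only [Finset.mem_filter, Finset.mem_compl]
    refine ⟨fun hes => h1 e hes rfl, Finset.insert_subset heF hs.1, ?_⟩
    intro a ha b hb hab
    rw [Finset.mem_insert] at ha hb
    rcases ha with rfl | ha <;> rcases hb with rfl | hb
    · exact absurd rfl hab
    · exact ⟨fun h => h1 b hb h.symm, fun h => h2 b hb h.symm⟩
    · exact ⟨h1 a ha, h2 a ha⟩
    · exact hs.2 a ha b hb hab
  have hmeet : (F.filter fun e => ¬(l e ∉ A ∧ ρ e ∉ B)).card ≤ ((Aᶜ ×ˢ Bᶜ)ᶜ).card := by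
    refine Finset.card_le_card_of_injOn (fun e => (l e, ρ e)) ?_ ?_
    · intro e he
      simpa using (Finset.mem_filter.1 he).2
    · intro e he f hf h
      exact hinj e (Finset.mem_filter.1 he).1 f (Finset.mem_filter.1 hf).1
        (Prod.mk.inj h).1 (Prod.mk.inj h).2
  have hcompl := Finset.card_compl_add_card (Aᶜ ×ˢ Bᶜ)
  rw [Finset.card_product, Finset.card_compl A, Finset.card_compl B, hAc, hBc, Fintype.card_prod,
    Fintype.card_fin, ← sq, ← sq] at hcompl
  omega

/-- The number `x ≥ N - n ^ 2 + (n - d) ^ 2` of extensions exceeds `d` if `d < N / n - n / 3 - 1 / 2`: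
the difference is more than `n ^ 2 / 3 - n * d + d ^ 2 + n / 2 - d`, which is
`(3 * (2 * d - n - 1) ^ 2 + n ^ 2 - 3) / 12`. -/
theorem lt_of_lt_of_card_le {n d N x : ℕ} (hn : 0 < n) (hdn : d ≤ n) (hN : N ≤ n ^ 2)
    (hd : (d : ℝ) < (N : ℝ) / n - (n : ℝ) / 3 - 1 / 2)
    (hx : N + (n - d) ^ 2 ≤ x + n ^ 2) : d < x := by
  have hn' : (0 : ℝ) < n := by exact_mod_cast hn
  have h1 : (n : ℝ) * (d + n / 3 + 1 / 2) < N := by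
    have : (d : ℝ) + n / 3 + 1 / 2 < N / n := by linarith
    rw [lt_div_iff₀ hn'] at this
    linarith
  have h2 : (N : ℝ) + ((n : ℝ) - d) ^ 2 ≤ x + (n : ℝ) ^ 2 := by
    have := (Nat.cast_le (α := ℝ)).2 hx
    push_cast [Nat.cast_sub hdn] at this
    exact this
  have hN' : (N : ℝ) ≤ (n : ℝ) ^ 2 := by exact_mod_cast hN
  suffices (d : ℝ) < x by exact_mod_cast this
  rcases Nat.lt_or_ge n 2 with h | h
  · -- For `n = 1` only `d = 0` is in the range, and the general estimate fails at `d = 1`.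
    obtain rfl : n = 1 := by omega
    simp only [Nat.cast_one] at h1 h2 hN'
    have hd0 : d = 0 := by
      by_contra h0
      have : (1 : ℝ) ≤ d := by exact_mod_cast Nat.one_le_iff_ne_zero.2 h0
      linarith
    subst hd0
    simp only [Nat.cast_zero] at h1 h2 ⊢
    linarith
  · have hn2 : (2 : ℝ) ≤ n := by exact_mod_cast h
    nlinarith [sq_nonneg (2 * (d : ℝ) - n - 1)]

end PreAbstractSimplicialComplex

/-! ### Matching complexes of subgraphs of `K_{n,n}` -/

open PreAbstractSimplicialComplex

/-- The faces of the matching complex of a bipartite graph, and the empty set, are the sets on which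
both endpoint maps are injective. -/
theorem eq_empty_or_mem_matchingComplex_iff {n : ℕ} {F : Finset (Sym2 (Fin n ⊕ Fin n))}
    {l ρ : Sym2 (Fin n ⊕ Fin n) → Fin n}
    (he : ∀ e ∈ F, e = s(Sum.inl (l e), Sum.inr (ρ e))) (s : Finset (Sym2 (Fin n ⊕ Fin n))) :
    (s = ∅ ∨ s ∈ (matchingComplex (F : Set (Sym2 (Fin n ⊕ Fin n)))).faces)
      ↔ IsRookPlacement F l ρ s := by
  have hmem : ∀ e ∈ F, ∀ v, v ∈ e ↔ v = Sum.inl (l e) ∨ v = Sum.inr (ρ e) := by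
    intro e hF v
    conv_lhs => rw [he e hF]
    exact Sym2.mem_iff
  constructor
  · rintro (rfl | ⟨-, hsF, hs⟩)
    · exact ⟨by simp, by simp⟩
    · have hsF' : s ⊆ F := by exact_mod_cast hsF
      refine ⟨hsF', fun e hes f hfs hef => ⟨fun h => ?_, fun h => ?_⟩⟩
      · exact hs e hes f hfs hef (Sum.inl (l e)) ((hmem e (hsF' hes) _).2 (Or.inl rfl))
          ((hmem f (hsF' hfs) _).2 (Or.inl (congrArg Sum.inl h)))
      · exact hs e hes f hfs hef (Sum.inr (ρ e)) ((hmem e (hsF' hes) _).2 (Or.inr rfl))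
          ((hmem f (hsF' hfs) _).2 (Or.inr (congrArg Sum.inr h)))
  · rintro ⟨hsF, hs⟩
    rcases s.eq_empty_or_nonempty with h | h
    · exact Or.inl h
    · refine Or.inr ⟨h, by exact_mod_cast hsF, fun e hes f hfs hef v hve hvf => ?_⟩
      obtain ⟨h1, h2⟩ := hs e hes f hfs hef
      rw [hmem e (hsF hes)] at hve
      rw [hmem f (hsF hfs)] at hvf
      rcases hve with rfl | rfl <;> rcases hvf with h | h
      · exact h1 (Sum.inl_injective h)
      · exact Sum.inl_ne_inr h
      · exact Sum.inr_ne_inl h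
      · exact h2 (Sum.inr_injective h)

theorem subsingleton_reducedHomology_matchingComplex {n : ℕ} (hn : 0 < n)
    {F : Finset (Sym2 (Fin n ⊕ Fin n))} {l ρ : Sym2 (Fin n ⊕ Fin n) → Fin n}
    (he : ∀ e ∈ F, e = s(Sum.inl (l e), Sum.inr (ρ e))) {d : ℕ} {j : ℤ} (hj : j + 1 = d)
    (hd : (d : ℝ) < (F.card : ℝ) / n - (n : ℝ) / 3 - 1 / 2) :
    Subsingleton ((matchingComplex (F : Set (Sym2 (Fin n ⊕ Fin n)))).ReducedHomology j) := by
  classical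
  have hinj : ∀ u ∈ F, ∀ v ∈ F, l u = l v → ρ u = ρ v → u = v := by
    intro u hu v hv h1 h2
    rw [he u hu, he v hv, h1, h2]
  have hFn : F.card ≤ n ^ 2 := by
    have : F.card ≤ (Finset.univ : Finset (Fin n × Fin n)).card :=
      Finset.card_le_card_of_injOn (fun e => (l e, ρ e)) (by simp) fun u hu v hv h =>
        hinj u hu v hv (Prod.mk.inj h).1 (Prod.mk.inj h).2
    simpa [sq] using this
  refine subsingleton_reducedHomology_of_harmonic _ j fun z hz hco => ?_
  refine eq_zero_of_harmonic (d := d) hinj ?_ ?_ ?_ ?_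
  · intro s hs
    obtain ⟨h1, h2⟩ := (Finsupp.mem_supported ℚ z).1 hz.1 (Finsupp.mem_support_iff.2 hs)
    exact ⟨(eq_empty_or_mem_matchingComplex_iff he s).1 h1, by omega⟩
  · intro s hs hc
    obtain ⟨hdn, hx⟩ := card_le_card_extensions_add hinj hs hc
    exact lt_of_lt_of_card_le hn hdn hFn hd hx
  · intro r
    rw [← boundary_apply, LinearMap.mem_ker.1 hz.2, Finsupp.zero_apply]
  · intro t ht hc
    exact hco t ((eq_empty_or_mem_matchingComplex_iff he t).2 ht) (by omega)

theorem exists_endpoint_maps {n : ℕ} (hn : 0 < n) {F : Finset (Sym2 (Fin n ⊕ Fin n))}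
    (hF : (F : Set (Sym2 (Fin n ⊕ Fin n))) ⊆ (completeBipartiteGraph (Fin n) (Fin n)).edgeSet) :
    ∃ l ρ : Sym2 (Fin n ⊕ Fin n) → Fin n, ∀ e ∈ F, e = s(Sum.inl (l e), Sum.inr (ρ e)) := by
  have h : ∀ e : Sym2 (Fin n ⊕ Fin n), ∃ a b : Fin n, e ∈ F → e = s(Sum.inl a, Sum.inr b) := by
    intro e
    by_cases heF : e ∈ F
    · have hE := hF heF
      induction e with
      | h x y =>
        rw [SimpleGraph.mem_edgeSet] at hE
        rcases x with a | a <;> rcases y with b | b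
        · simp at hE
        · exact ⟨a, b, fun _ => rfl⟩
        · exact ⟨b, a, fun _ => Sym2.eq_swap⟩
        · simp at hE
    · exact ⟨⟨0, hn⟩, ⟨0, hn⟩, fun h => absurd h heF⟩
  choose l ρ hlρ using h
  exact ⟨l, ρ, hlρ⟩

theorem theorem3p7 (n : ℕ) (hn : 0 < n) (F : Finset (Sym2 (Fin n ⊕ Fin n)))
    (hF : (F : Set (Sym2 (Fin n ⊕ Fin n))) ⊆ (completeBipartiteGraph (Fin n) (Fin n)).edgeSet) :
    (((F.card : ℝ) / (n : ℝ) - (n : ℝ) / 3 - 1 / 2 : ℝ) : EReal)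
      ≤ (((matchingComplex (F : Set (Sym2 (Fin n ⊕ Fin n)))).etaH : ℝ≥0∞) : EReal) := by
  obtain ⟨l, ρ, he⟩ := exists_endpoint_maps hn hF
  set x : ℝ := (F.card : ℝ) / (n : ℝ) - (n : ℝ) / 3 - 1 / 2 with hx
  have hconn : (matchingComplex (F : Set (Sym2 (Fin n ⊕ Fin n)))).IsHomologicallyConnected
      ((⌈x⌉₊ : ℤ) - 2) := by
    intro j hj1 hj2
    obtain ⟨d, hd⟩ : ∃ d : ℕ, j + 1 = d := ⟨(j + 1).toNat, by omega⟩
    refine subsingleton_reducedHomology_matchingComplex hn he hd (Nat.lt_ceil.1 ?_)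
    rw [← hx]
    omega
  have heta : ((⌈x⌉₊ : ℕ) : ℕ∞)
      ≤ (matchingComplex (F : Set (Sym2 (Fin n ⊕ Fin n)))).etaH :=
    le_iSup₂_of_le ⌈x⌉₊ hconn le_rfl
  calc (x : EReal) ≤ ((⌈x⌉₊ : ℝ) : EReal) := EReal.coe_le_coe_iff.2 (Nat.le_ceil x)
    _ = (((⌈x⌉₊ : ℕ∞) : ℝ≥0∞) : EReal) := by
      rw [ENat.toENNReal_coe, ← ENNReal.coe_natCast, EReal.coe_nnreal_eq_coe_real,
        NNReal.coe_natCast]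
    _ ≤ _ := EReal.coe_ennreal_le_coe_ennreal_iff.2 (ENat.toENNReal_le.2 heta)
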